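/- **Setting.** Let $Y=f+\varepsilon$, where $f\in\mathbb R^n$ is arbitrary and $\varepsilon_1,\dots,\varepsilon_n$ are independent centered Gaussian variables with common variance $\sigma^2>0$. Let $X$ be a real $n\times p$ matrix with $p\ge 2$. For $m\subset\{1,\dots,p\}$ let $S_m$ be the linear span of the columns $X_{\cdot,j}$, $j\in m$ (so $S_\varnothing=\{0\}$), and let $\Pi_S$ denote the orthogonal projection onto a linear space $S\subset\mathbb R^n$. Fix $K>1$, $\alpha>0$, $\kappa\in(0,1)$ and a positive integer $D_{\max}$ with $D_{\max}\le n-2$ and $D_{\max}\le \kappa n/(2\log p)$. Put $\mathbb S=\{S_m : |m|\le D_{\max}\}$ and, for $S\in\mathbb S$ with $D=\dim S$, $$\Delta(S)=\log\binom pD+\log(1+D),\qquad \widehat\sigma_S^2=\frac{\|Y-\Pi_SY\|^2}{n-D}.$$ Let $\mathrm{pen}_\Delta(S)\ge 0$ be defined by $$\mathbb E\Big[\Big(U-\tfrac{\mathrm{pen}_\Delta(S)}{n-D}V\Big)_+\Big]=e^{-\Delta(S)},$$ where $U,V$ are independent $\chi^2$ variables with $D+1$ and $n-D-1$ degrees of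 freedom, and put $\mathrm{pen}(S)=K\,\mathrm{pen}_\Delta(S)$. Let $\Lambda$ be a finite set. For each $\lambda\in\Lambda$ let $\widehat m(\lambda)$ be a random subset of $\{1,\dots,p\}$ based on $Y$ with $|\widehat m(\lambda)|\le D_{\max}$, let $\widehat f_\lambda$ be an estimator of $f$ based on $Y$ with $\widehat f_\lambda\in S_{\widehat m(\lambda)}$ almost surely, and let $\mathbb S_\lambda\subset\mathbb S$ be a (possibly random, based on $Y$) family of spaces with $S_{\widehat m(\lambda)}\in\mathbb S_\lambda$. Let $\widehat f_{\widehat\lambda}$, with $\widehat\lambda\in\Lambda$ based on $Y$, be any selected estimator minimizing over $\lambda\in\Lambda$ the criterion $$\mathrm{crit}_\alpha(\widehat f_\lambda)=\inf_{S\in\mathbb S_\lambda}\Big[\|Y-\Pi_S\widehat f_\lambda\|^2+\alpha\|\widehat f_\lambda-\Pi_S\widehat f_\lambda\|^2+\mathrm{pen}(S)\,\widehat\sigma_S^2\Big].$$ **Claim.** There is a constant $C>0$ depending only on $K$, $\kappa$ and $\alpha$ such that the following holds. If $S_{\widehat m(\lambda)}\ne\{0\}$ almost surely for every $\lambda\in\Lambda$,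 then $$C\,\mathbb E\big[\|f-\widehat f_{\widehat\lambda}\|^2\big]\le\inf_{\lambda\in\Lambda}\Big[\mathbb E\big[\|f-\widehat f_\lambda\|^2\big]+\mathbb E\big[\dim S_{\widehat m(\lambda)}\big]\log(p)\,\sigma^2\Big].$$ Without this non-degeneracy condition, $$C\,\mathbb E\big[\|f-\widehat f_{\widehat\lambda}\|^2\big]\le\inf_{\lambda\in\Lambda}\Big[\mathbb E\big[\|f-\widehat f_\lambda\|^2\big]+\mathbb E\big[\max(\dim S_{\widehat m(\lambda)},1)\big]\log(p)\,\sigma^2\Big].$$ Expectations take values in $[0,+\infty]$. -/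

import Mathlib

open MeasureTheory ProbabilityTheory
open scoped ENNReal NNReal

namespace EstimatorSelection

noncomputable section

/-- `S_m`: the span in `ℝⁿ` of the columns (predictors) of `X` with index in `m`
(so `S_∅ = {0}`). -/
def columnSpan {n p : ℕ} (X : Matrix (Fin n) (Fin p) ℝ) (m : Finset (Fin p)) :
    Submodule ℝ (EuclideanSpace ℝ (Fin n)) :=
  Submodule.span ℝ ((fun j : Fin p => WithLp.toLp 2 (fun i : Fin n => X i j)) '' (m : Set (Fin p)))

/-- The family `𝕊` of all the spaces `S_m` with `|m| ≤ Dmax`. -/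
def modelFamily {n p : ℕ} (X : Matrix (Fin n) (Fin p) ℝ) (Dmax : ℕ) :
    Set (Submodule ℝ (EuclideanSpace ℝ (Fin n))) :=
  {S | ∃ m : Finset (Fin p), m.card ≤ Dmax ∧ S = columnSpan X m}

/-- The weight `Δ(S) = log (p choose D) + log (1 + D)` with `D = dim S`. -/
def weight {n : ℕ} (p : ℕ) (S : Submodule ℝ (EuclideanSpace ℝ (Fin n))) : ℝ :=
  Real.log (p.choose (Module.finrank ℝ S) : ℝ) + Real.log (1 + (Module.finrank ℝ S : ℝ))

/-- The `χ²` law with `k` degrees of freedom: the law of the sum of the squares of `k` independent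
standard Gaussian variables. -/
def chiSq (k : ℕ) : Measure ℝ :=
  (Measure.pi (fun _ : Fin k => gaussianReal 0 1)).map (fun x => ∑ i, x i ^ 2)

/-- `𝔼 (U - x V / (n - d))₊` for independent `χ²` variables `U`, `V` with `d + 1` and `n - d - 1`
degrees of freedom (used for `d + 2 ≤ n` only). -/
def expectedExcess (n d : ℕ) (x : ℝ) : ℝ :=
  ∫ z : ℝ × ℝ, max (z.1 - x / ((n : ℝ) - (d : ℝ)) * z.2) 0
    ∂((chiSq (d + 1)).prod (chiSq (n - d - 1)))

/-- `pen_Δ(S)`: the number `x ≥ 0` with `𝔼 (U - x V / (n - dim S))₊ = exp (-Δ(S))`. For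
`dim S + 2 ≤ n` there is exactly one such `x`, and the infimum below is taken over a singleton. -/
def penDelta {n : ℕ} (p : ℕ) (S : Submodule ℝ (EuclideanSpace ℝ (Fin n))) : ℝ :=
  sInf {x : ℝ | 0 ≤ x ∧ expectedExcess n (Module.finrank ℝ S) x = Real.exp (-weight p S)}

/-- The variance estimator `‖y - Π_S y‖² / (n - dim S)`. -/
def sigmaHatSq {n : ℕ} (S : Submodule ℝ (EuclideanSpace ℝ (Fin n)))
    (y : EuclideanSpace ℝ (Fin n)) : ℝ :=
  ‖y - S.starProjection y‖ ^ 2 / ((n : ℝ) - (Module.finrank ℝ S : ℝ))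

/-- The criterion at the observation `y` of an estimator with value `g`, to which the family `T` of
approximation spaces is associated: the infimum over `S ∈ T` of
`‖y - Π_S g‖² + α ‖g - Π_S g‖² + pen(S) σ̂²_S`, with `pen = K pen_Δ`. -/
def crit {n : ℕ} (p : ℕ) (K α : ℝ) (T : Set (Submodule ℝ (EuclideanSpace ℝ (Fin n))))
    (y g : EuclideanSpace ℝ (Fin n)) : ℝ :=
  ⨅ S : T, (‖y - (S : Submodule ℝ (EuclideanSpace ℝ (Fin n))).starProjection g‖ ^ 2
    + α * ‖g - (S : Submodule ℝ (EuclideanSpace ℝ (Fin n))).starProjection g‖ ^ 2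
    + K * penDelta p (S : Submodule ℝ (EuclideanSpace ℝ (Fin n)))
        * sigmaHatSq (S : Submodule ℝ (EuclideanSpace ℝ (Fin n))) y)

end

end EstimatorSelection

/-! Let `g` be the selected estimator, `S` a space attaining its criterion and `u = Π_S g`. Since
`S` depends on the data, the cross term `2⟨ε, f - u⟩` has to be controlled simultaneously over all
models. Attach to each `S` of dimension `d` a deterministic space `W` of dimension `d + 1`
containing both `S` and `f`. As `f - u ∈ W`, the cross term is at most `K⁻¹‖f - u‖² + K‖Π_W ε‖²` in
absolute value. Moreover `‖Y - Π_S Y‖ ≥ ‖ε - Π_W ε‖`, so the penalty `K pen_Δ(S) σ̂²_S` pays for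
`K‖Π_W ε‖²` up to an excess. The squared norms of `Π_W ε` and `ε - Π_W ε` are independent `σ²χ²`
variables with `d + 1` and `n - d - 1` degrees of freedom, so the definition of `pen_Δ` makes the
mean excess exactly `σ² exp (-Δ(S))`. There are at most `p choose d` spaces of dimension `d`; the
sum over the family is thus at most a harmonic sum, of order `σ² log p` (`oracle_inequality`,
`lintegral_totalExcess_le`).

The competitor's penalty must also be small. A Chernoff bound gives `pen_Δ(S) ≤ e⁴⁰ max(d, 1) log p`
(`penDelta_spec`). It multiplies a residual at most `2‖f - g'‖² + 2‖ε‖²`, and `‖ε‖²` exceeds `4nσ²`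
only by a remainder of mean at most `4σ²`; this separates the random penalty from the noise.
Remaining multiples of `σ²` and `σ² log p` are absorbed because `max(dim, 1) ≥ 1`. -/

namespace EstimatorSelection

/-! ### Chi-square laws: Laplace transform and mean -/

lemma measurable_sum_sq (k : ℕ) : Measurable fun x : Fin k → ℝ => ∑ i, x i ^ 2 := by
  fun_prop

instance isProbabilityMeasure_chiSq (k : ℕ) : IsProbabilityMeasure (chiSq k) :=
  Measure.isProbabilityMeasure_map (measurable_sum_sq k).aemeasurable

lemma chiSq_ae_nonneg (k : ℕ) : ∀ᵐ u ∂(chiSq k), 0 ≤ u := by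
  rw [chiSq, ae_map_iff (measurable_sum_sq k).aemeasurable measurableSet_Ici]
  exact ae_of_all _ fun x => Finset.sum_nonneg fun i _ => sq_nonneg _

lemma integrable_exp_mul_sq_gaussianReal {t : ℝ} (ht : t < 1 / 2) :
    Integrable (fun x : ℝ => Real.exp (t * x ^ 2)) (gaussianReal 0 1) := by
  rw [gaussianReal_of_var_ne_zero _ one_ne_zero, integrable_withDensity_iff (by fun_prop)
    (ae_of_all _ fun x => by simp [gaussianPDF])]
  have h : (fun x : ℝ => Real.exp (t * x ^ 2) * (gaussianPDF 0 1 x).toReal)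
      = fun x => (√(2 * Real.pi))⁻¹ * Real.exp (-(1 / 2 - t) * x ^ 2) := by
    funext x
    rw [toReal_gaussianPDF, gaussianPDFReal]
    rw [mul_left_comm, ← Real.exp_add]
    simp only [NNReal.coe_one, mul_one, sub_zero]
    congr 2
    ring
  rw [h]
  exact (integrable_exp_neg_mul_sq (by linarith)).const_mul _

lemma integral_exp_mul_sq_gaussianReal {t : ℝ} (ht : t < 1 / 2) :
    ∫ x : ℝ, Real.exp (t * x ^ 2) ∂(gaussianReal 0 1) = (√(1 - 2 * t))⁻¹ := by
  rw [integral_gaussianReal_eq_integral_smul one_ne_zero]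
  have h : ∀ x : ℝ, gaussianPDFReal 0 1 x • Real.exp (t * x ^ 2)
      = (√(2 * Real.pi))⁻¹ * Real.exp (-(1 / 2 - t) * x ^ 2) := by
    intro x
    rw [gaussianPDFReal, smul_eq_mul, mul_assoc, ← Real.exp_add]
    simp only [NNReal.coe_one, mul_one, sub_zero]
    congr 2
    ring
  simp_rw [h]
  rw [integral_const_mul, integral_gaussian, ← Real.sqrt_inv, ← Real.sqrt_inv,
    ← Real.sqrt_mul (by positivity)]
  congr 1
  have : 1 - 2 * t ≠ 0 := by linarith
  have : 1 / 2 - t ≠ 0 := by linarith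
  field_simp

lemma integrable_exp_mul_chiSq (k : ℕ) {t : ℝ} (ht : t < 1 / 2) :
    Integrable (fun u => Real.exp (t * u)) (chiSq k) := by
  rw [chiSq, integrable_map_measure (by fun_prop) (measurable_sum_sq k).aemeasurable]
  simp only [Function.comp_def, Finset.mul_sum, Real.exp_sum]
  exact Integrable.fintype_prod (f := fun _ x => Real.exp (t * x ^ 2))
    fun _ => integrable_exp_mul_sq_gaussianReal ht

lemma integral_exp_mul_chiSq (k : ℕ) {t : ℝ} (ht : t < 1 / 2) :
    ∫ u, Real.exp (t * u) ∂(chiSq k) = (√(1 - 2 * t))⁻¹ ^ k := by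
  rw [chiSq, integral_map (measurable_sum_sq k).aemeasurable (by fun_prop)]
  simp only [Finset.mul_sum, Real.exp_sum]
  rw [integral_fintype_prod_eq_prod (fun _ x => Real.exp (t * x ^ 2))]
  simp [integral_exp_mul_sq_gaussianReal ht]

/-- Basis of the Chernoff bounds: the rate `1/4` is below `1/2`, where the chi-square Laplace
transform stops being finite. -/
lemma max_le_four_mul_exp (a : ℝ) : max a 0 ≤ 4 * Real.exp (a / 4) :=
  max_le (by linarith [Real.add_one_le_exp (a / 4)]) (by positivity)

lemma integrable_id_chiSq (k : ℕ) : Integrable (fun u => u) (chiSq k) := by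
  refine ((integrable_exp_mul_chiSq k (t := 1 / 4) (by norm_num)).const_mul 4).mono'
    (by fun_prop) ?_
  filter_upwards [chiSq_ae_nonneg k] with u hu
  rw [Real.norm_of_nonneg hu]
  calc u ≤ max u 0 := le_max_left _ _
    _ ≤ 4 * Real.exp (u / 4) := max_le_four_mul_exp u
    _ = _ := by ring_nf

lemma integral_id_chiSq (k : ℕ) : ∫ u, u ∂(chiSq k) = k := by
  have hi : Integrable (fun x : ℝ => x ^ 2) (gaussianReal 0 1) :=
    (memLp_id_gaussianReal 2).integrable_sq
  have h1 : ∫ x : ℝ, x ^ 2 ∂(gaussianReal 0 1) = 1 := by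
    have := variance_id_gaussianReal (μ := 0) (v := 1)
    rw [variance_of_integral_eq_zero (by fun_prop) (by simp)] at this
    simpa using this
  rw [chiSq, integral_map (measurable_sum_sq k).aemeasurable (by fun_prop), integral_finsetSum]
  · have : ∀ i : Fin k, ∫ x : Fin k → ℝ, x i ^ 2 ∂(Measure.pi fun _ => gaussianReal 0 1) = 1 := by
      intro i
      have h := measurePreserving_eval (fun _ : Fin k => gaussianReal 0 1) i
      rw [← h1]
      conv_rhs => rw [← h.map_eq]
      rw [integral_map h.measurable.aemeasurable (by fun_prop)]
    simp [this]
  · intro i _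
    exact integrable_comp_eval (μ := fun _ : Fin k => gaussianReal 0 1) (i := i)
      (f := fun x : ℝ => x ^ 2) hi

/-! ### The expected excess as a function of the penalty -/

lemma integrable_excess (k l : ℕ) {y : ℝ} (hy : 0 ≤ y) :
    Integrable (fun z : ℝ × ℝ => max (z.1 - y * z.2) 0) ((chiSq k).prod (chiSq l)) := by
  refine ((integrable_id_chiSq k).comp_fst (chiSq l)).mono (by fun_prop) ?_
  filter_upwards [Measure.quasiMeasurePreserving_fst.ae (chiSq_ae_nonneg k),
    Measure.quasiMeasurePreserving_snd.ae (chiSq_ae_nonneg l)] with z h1 h2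
  rw [Real.norm_of_nonneg (le_max_right _ _), Real.norm_of_nonneg h1]
  exact max_le (by nlinarith) h1

lemma expectedExcess_zero (n d : ℕ) : expectedExcess n d 0 = d + 1 := by
  have : expectedExcess n d 0 = ∫ z : ℝ × ℝ, z.1 ∂((chiSq (d + 1)).prod (chiSq (n - d - 1))) := by
    refine integral_congr_ae ?_
    filter_upwards [Measure.quasiMeasurePreserving_fst.ae (chiSq_ae_nonneg (d + 1))] with z h1
    simpa using h1
  rw [this, integral_fun_fst (fun u => u), integral_id_chiSq]
  simp

lemma continuousOn_expectedExcess {n d : ℕ} (hd : d < n) :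
    ContinuousOn (expectedExcess n d) (Set.Ici 0) := by
  have hN : (0 : ℝ) < (n : ℝ) - d := by rw [sub_pos]; exact_mod_cast hd
  refine continuousOn_of_dominated (bound := fun z : ℝ × ℝ => z.1) ?_ ?_ ?_ ?_
  · intro x _
    fun_prop
  · intro x hx
    filter_upwards [Measure.quasiMeasurePreserving_fst.ae (chiSq_ae_nonneg (d + 1)),
      Measure.quasiMeasurePreserving_snd.ae (chiSq_ae_nonneg (n - d - 1))] with z h1 h2
    rw [Real.norm_of_nonneg (le_max_right _ _)]
    refine max_le ?_ h1
    have : 0 ≤ x / ((n : ℝ) - d) * z.2 := mul_nonneg (div_nonneg hx hN.le) h2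
    linarith
  · exact (integrable_id_chiSq _).comp_fst _
  · refine ae_of_all _ fun z => ?_
    fun_prop

/-- Bound the positive part by `4 exp (· / 4)`; independence then factors the expectation into two
Laplace transforms. -/
lemma expectedExcess_le {n d : ℕ} (hd : d < n) {x : ℝ} (hx : 0 ≤ x) :
    expectedExcess n d x
      ≤ 4 * √2 ^ (d + 1) * (√(1 + x / (n - d) / 2))⁻¹ ^ (n - d - 1) := by
  have hN : (0 : ℝ) < (n : ℝ) - d := by rw [sub_pos]; exact_mod_cast hd
  set y := x / ((n : ℝ) - d) with hy
  have hy0 : 0 ≤ y := div_nonneg hx hN.le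
  have e1 := integral_exp_mul_chiSq (d + 1) (t := 1 / 4) (by norm_num)
  have e2 := integral_exp_mul_chiSq (n - d - 1) (t := - (y / 4)) (by linarith)
  have i1 := integrable_exp_mul_chiSq (d + 1) (t := 1 / 4) (by norm_num)
  have i2 := integrable_exp_mul_chiSq (n - d - 1) (t := - (y / 4)) (by linarith)
  have s1 : (√(1 - 2 * (1 / 4 : ℝ)))⁻¹ = √2 := by rw [← Real.sqrt_inv]; norm_num
  have s2 : 1 - 2 * (-(y / 4)) = 1 + y / 2 := by ring
  rw [s1] at e1
  rw [s2] at e2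
  calc expectedExcess n d x
      ≤ ∫ z : ℝ × ℝ, 4 * (Real.exp (1 / 4 * z.1) * Real.exp (-(y / 4) * z.2))
          ∂((chiSq (d + 1)).prod (chiSq (n - d - 1))) := by
        refine integral_mono (integrable_excess _ _ hy0) ((i1.mul_prod i2).const_mul 4) ?_
        intro z
        beta_reduce
        refine (max_le_four_mul_exp _).trans (le_of_eq ?_)
        rw [← Real.exp_add]
        congr 2
        ring
    _ = _ := by
        rw [integral_const_mul, integral_prod_mul (fun u => Real.exp (1 / 4 * u))
          (fun v => Real.exp (-(y / 4) * v)), e1, e2, mul_assoc]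

/-! ### Weights, complexities and the size of the penalty -/

/-- The log-weight `log (p choose d) + log (1 + d)` of a space of dimension `d`. -/
noncomputable def dimWeight (p d : ℕ) : ℝ := Real.log (p.choose d : ℝ) + Real.log (1 + (d : ℝ))

/-- The complexity `max (d, 1) log p` of a space of dimension `d`. -/
noncomputable def complexity (p d : ℕ) : ℝ := max (d : ℝ) 1 * Real.log p

lemma exp_neg_dimWeight {p d : ℕ} (hdp : d ≤ p) :
    Real.exp (-dimWeight p d) = ((p.choose d : ℝ) * (1 + d))⁻¹ := by
  have h : (0 : ℝ) < p.choose d := by exact_mod_cast Nat.choose_pos hdp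
  rw [dimWeight, Real.exp_neg, Real.exp_add, Real.exp_log h, Real.exp_log (by positivity)]

lemma log_two_le_log {p : ℕ} (hp : 2 ≤ p) : Real.log 2 ≤ Real.log p :=
  Real.log_le_log (by norm_num) (by exact_mod_cast hp)

lemma complexity_nonneg (p d : ℕ) : 0 ≤ complexity p d :=
  mul_nonneg (by positivity) (Real.log_natCast_nonneg p)

lemma max_mul_log_two_le_complexity {p : ℕ} (hp : 2 ≤ p) (d : ℕ) :
    max (d : ℝ) 1 * Real.log 2 ≤ complexity p d :=
  mul_le_mul_of_nonneg_left (log_two_le_log hp) (by positivity)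

lemma dimWeight_le {p d : ℕ} (hp : 2 ≤ p) (hdp : d ≤ p) :
    dimWeight p d ≤ 2 * complexity p d := by
  have h1 : Real.log (p.choose d : ℝ) ≤ complexity p d := by
    calc Real.log (p.choose d : ℝ) ≤ Real.log ((p : ℝ) ^ d) :=
          Real.log_le_log (by exact_mod_cast Nat.choose_pos hdp)
            (by exact_mod_cast Nat.choose_le_pow p d)
      _ = d * Real.log p := Real.log_pow _ _
      _ ≤ _ := mul_le_mul_of_nonneg_right (le_max_left _ _) (Real.log_natCast_nonneg p)
  have h2 : Real.log (1 + (d : ℝ)) ≤ complexity p d := by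
    refine le_trans ?_ (max_mul_log_two_le_complexity hp d)
    calc Real.log (1 + (d : ℝ)) ≤ Real.log ((2 : ℝ) ^ d) := by
          refine Real.log_le_log (by positivity) ?_
          have : d + 1 ≤ 2 ^ d := Nat.lt_two_pow_self
          have : ((d + 1 : ℕ) : ℝ) ≤ ((2 ^ d : ℕ) : ℝ) := by exact_mod_cast this
          push_cast at this
          linarith
      _ = d * Real.log 2 := Real.log_pow _ _
      _ ≤ _ := mul_le_mul_of_nonneg_right (le_max_left _ _) (Real.log_nonneg (by norm_num))
  unfold dimWeight
  linarith

/-- Here `d log 2 ≤ n / 2` with `log 2 > 2/3`, so `d ≤ 3n/4`. -/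
lemma le_four_mul_sub {n p d : ℕ} (hp : 2 ≤ p) (hL : complexity p d ≤ n / 2) :
    (n : ℝ) ≤ 4 * (n - d) := by
  have h1 := max_mul_log_two_le_complexity hp d
  have h2 : (d : ℝ) * Real.log 2 ≤ max (d : ℝ) 1 * Real.log 2 :=
    mul_le_mul_of_nonneg_right (le_max_left _ _) (Real.log_nonneg (by norm_num))
  have h3 := Real.log_two_gt_d9
  have h4 : (0 : ℝ) ≤ d := by positivity
  nlinarith

/-- Bernoulli's inequality for the exponent `θ ∈ [0, 1]`. It turns the factor `e⁴⁰` of the penalty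
into a lower bound on a logarithm that is linear in `θ`. -/
lemma exp_forty_mul_le {θ : ℝ} (h0 : 0 ≤ θ) (h1 : θ ≤ 1) :
    Real.exp (40 * θ) ≤ 1 + θ * Real.exp 40 := by
  refine le_trans ?_ (rpow_one_add_le_one_add_mul_self (s := Real.exp 40)
    (by linarith [Real.exp_pos 40]) h0 h1)
  rw [Real.exp_mul]
  exact Real.rpow_le_rpow (Real.exp_pos _).le (by linarith) h0

lemma sqrt_pow_eq_exp {a : ℝ} (ha : 0 < a) (k : ℕ) :
    √a ^ k = Real.exp (k * (Real.log a / 2)) := by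
  rw [← Real.log_sqrt ha.le, mul_comm, Real.exp_mul, Real.exp_log (Real.sqrt_pos.2 ha),
    Real.rpow_natCast]

/-- Budget in the exponent, with `L` the complexity: `log 4 ≤ 2L`, `(d + 1)(log 2)/2 ≤ L` and the
weight is at most `2L`. The decaying factor must therefore supply `5L`, which dictates the constant
40. -/
lemma expectedExcess_exp_forty_le {n p d : ℕ} (hp : 2 ≤ p) (hdp : d ≤ p) (hdn : d + 2 ≤ n)
    (hL : complexity p d ≤ n / 2) :
    expectedExcess n d (Real.exp 40 * complexity p d) ≤ Real.exp (-dimWeight p d) := by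
  set L := complexity p d with hLdef
  have hL0 : 0 ≤ L := complexity_nonneg p d
  have hN4 := le_four_mul_sub hp hL
  have hN2 : (2 : ℝ) ≤ n - d := by
    have : ((d + 2 : ℕ) : ℝ) ≤ n := by exact_mod_cast hdn
    push_cast at this
    linarith
  have hcast : ((n - d - 1 : ℕ) : ℝ) = (n : ℝ) - d - 1 := by
    rw [Nat.sub_sub, Nat.cast_sub (by omega)]
    push_cast
    ring
  set N : ℝ := (n : ℝ) - d with hN
  set a : ℝ := 1 + Real.exp 40 * L / N / 2 with ha
  have ha0 : 0 < a := by positivity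
  have hlog : 20 * (L / N) ≤ Real.log a := by
    rw [Real.le_log_iff_exp_le ha0]
    -- Admissible exponent: `L ≤ n/2 ≤ 2N`.
    have h1 : L / (2 * N) ≤ 1 := by
      rw [div_le_one (by linarith)]
      linarith
    have := exp_forty_mul_le (θ := L / (2 * N)) (by positivity) h1
    calc Real.exp (20 * (L / N)) = Real.exp (40 * (L / (2 * N))) := by
          congr 1
          field_simp
          ring
      _ ≤ _ := this
      _ = a := by
          rw [ha]
          field_simp
  refine (expectedExcess_le (by omega) (by positivity)).trans ?_
  rw [← hN, ← ha, inv_pow, sqrt_pow_eq_exp ha0, sqrt_pow_eq_exp two_pos, ← Real.exp_neg, hcast,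
    ← Real.exp_log (show (0 : ℝ) < 4 by norm_num), ← Real.exp_add, ← Real.exp_add]
  rw [Real.exp_le_exp]
  have hw := dimWeight_le hp hdp
  have hm := max_mul_log_two_le_complexity hp d
  have hlog2 : 0 ≤ Real.log 2 := Real.log_nonneg (by norm_num)
  have h4 : Real.log 4 = 2 * Real.log 2 := by
    rw [show (4 : ℝ) = 2 ^ 2 by norm_num, Real.log_pow]
    norm_num
  have hone : Real.log 2 ≤ max (d : ℝ) 1 * Real.log 2 := by
    nlinarith [le_max_right (d : ℝ) 1]
  have hdd : (d : ℝ) * Real.log 2 ≤ max (d : ℝ) 1 * Real.log 2 := by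
    nlinarith [le_max_left (d : ℝ) 1]
  -- `N ≥ 2` gives `N - 1 ≥ N / 2`, so the lost degree of freedom costs only a factor 2.
  have hmain : 5 * L ≤ (N - 1) * (Real.log a / 2) := by
    calc 5 * L = (N / 2) * (20 * (L / N) / 2) := by
          field_simp
          ring
      _ ≤ (N - 1) * (Real.log a / 2) := by
          have : 0 ≤ L / N := by positivity
          gcongr <;> linarith
  push_cast
  linarith

variable {n : ℕ}

lemma weight_eq_dimWeight (p : ℕ) (S : Submodule ℝ (EuclideanSpace ℝ (Fin n))) :
    weight p S = dimWeight p (Module.finrank ℝ S) := rfl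

lemma penDelta_nonneg (p : ℕ) (S : Submodule ℝ (EuclideanSpace ℝ (Fin n))) :
    0 ≤ penDelta p S :=
  Real.sInf_nonneg fun _ hx => hx.1

/-- The excess is `d + 1 ≥ exp (-Δ)` at `0` and at most `exp (-Δ)` at `e⁴⁰ L`, so continuity yields
a solution in between. The solution set is closed, hence contains its infimum; uniqueness is not
needed. -/
lemma penDelta_spec {p : ℕ} (hp : 2 ≤ p) {S : Submodule ℝ (EuclideanSpace ℝ (Fin n))}
    (hdp : Module.finrank ℝ S ≤ p) (hdn : Module.finrank ℝ S + 2 ≤ n)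
    (hL : complexity p (Module.finrank ℝ S) ≤ n / 2) :
    expectedExcess n (Module.finrank ℝ S) (penDelta p S) = Real.exp (-weight p S) ∧
      penDelta p S ≤ Real.exp 40 * complexity p (Module.finrank ℝ S) := by
  rw [penDelta, weight_eq_dimWeight]
  set d := Module.finrank ℝ S
  set A := {x : ℝ | 0 ≤ x ∧ expectedExcess n d x = Real.exp (-dimWeight p d)} with hA
  have hx0 : 0 ≤ Real.exp 40 * complexity p d :=
    mul_nonneg (Real.exp_pos _).le (complexity_nonneg p d)
  have hcont := continuousOn_expectedExcess (n := n) (d := d) (by omega)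
  have hle := expectedExcess_exp_forty_le hp hdp hdn hL
  have hge : Real.exp (-dimWeight p d) ≤ expectedExcess n d 0 := by
    rw [expectedExcess_zero, exp_neg_dimWeight hdp]
    have h : (1 : ℝ) ≤ p.choose d := by exact_mod_cast Nat.choose_pos hdp
    have hd : (0 : ℝ) ≤ d := by positivity
    calc ((p.choose d : ℝ) * (1 + d))⁻¹ ≤ 1 := inv_le_one_of_one_le₀ (by nlinarith)
      _ ≤ _ := by linarith
  obtain ⟨x, hx, hxe⟩ := intermediate_value_Icc' hx0
    (hcont.mono Set.Icc_subset_Ici_self) ⟨hle, hge⟩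
  have hmem : x ∈ A := ⟨hx.1, hxe⟩
  have hbdd : BddBelow A := ⟨0, fun y hy => hy.1⟩
  have hclosed : IsClosed A := by
    have := hcont.preimage_isClosed_of_isClosed isClosed_Ici
      (isClosed_singleton (x := Real.exp (-dimWeight p d)))
    exact this
  exact ⟨(hclosed.csInf_mem ⟨x, hmem⟩ hbdd).2, (csInf_le hbdd hmem).trans hx.2⟩

/-! ### Gaussian vectors and orthogonal projections -/

/-- The dimension is exactly `dim S + 1`, even when `f ∈ S`, so that the degrees of freedom match
those in the definition of `pen_Δ`. -/
lemma exists_finrank_eq_succ_of_lt {V : Type*} [AddCommGroup V] [Module ℝ V]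
    [Module.Finite ℝ V] (S : Submodule ℝ V) (f : V)
    (h : Module.finrank ℝ S < Module.finrank ℝ V) :
    ∃ W : Submodule ℝ V, S ≤ W ∧ f ∈ W ∧ Module.finrank ℝ W = Module.finrank ℝ S + 1 := by
  by_cases hf : f ∈ S
  · obtain ⟨v, hv⟩ : ∃ v, v ∉ S := by
      by_contra! hall
      rw [(Submodule.eq_top_iff'.2 hall : S = ⊤), finrank_top] at h
      exact lt_irrefl _ h
    exact ⟨S ⊔ Submodule.span ℝ {v}, le_sup_left, Submodule.mem_sup_left hf,
      Submodule.finrank_sup_span_singleton hv⟩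
  · exact ⟨S ⊔ Submodule.span ℝ {f}, le_sup_left,
      Submodule.mem_sup_right (Submodule.mem_span_singleton_self f),
      Submodule.finrank_sup_span_singleton hf⟩

lemma norm_sq_sum_smul {ι V : Type*} [Fintype ι] [NormedAddCommGroup V] [InnerProductSpace ℝ V]
    (b : OrthonormalBasis ι ℝ V) (x : ι → ℝ) : ‖∑ i, x i • b i‖ ^ 2 = ∑ i, x i ^ 2 := by
  have h : ∑ i, x i • b i = b.repr.symm (WithLp.toLp 2 x) := by
    rw [OrthonormalBasis.sum_repr_symm]
  rw [h, LinearIsometryEquiv.norm_map, EuclideanSpace.real_norm_sq_eq]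

/-- The standard Gaussian has independent standard coordinates in every orthonormal basis; take one
adapted to `W ⊕ Wᗮ`. -/
lemma map_norm_sq_starProjection_stdGaussian {k l : ℕ}
    (W : Submodule ℝ (EuclideanSpace ℝ (Fin n)))
    (hk : Module.finrank ℝ W = k) (hl : k + l = n) :
    (stdGaussian (EuclideanSpace ℝ (Fin n))).map
        (fun z => (‖W.starProjection z‖ ^ 2, ‖z - W.starProjection z‖ ^ 2))
      = (chiSq k).prod (chiSq l) := by
  have hl' : Module.finrank ℝ Wᗮ = l := by
    have := Submodule.finrank_add_finrank_orthogonal W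
    rw [finrank_euclideanSpace_fin] at this
    omega
  let b₁ : OrthonormalBasis (Fin k) ℝ W := (stdOrthonormalBasis ℝ W).reindex (finCongr hk)
  let b₂ : OrthonormalBasis (Fin l) ℝ Wᗮ := (stdOrthonormalBasis ℝ Wᗮ).reindex (finCongr hl')
  let b : OrthonormalBasis (Fin k ⊕ Fin l) ℝ (EuclideanSpace ℝ (Fin n)) :=
    (b₁.prod b₂).map W.orthogonalDecomposition.symm
  have hb₁ : ∀ i, b (Sum.inl i) = b₁ i := by
    intro i
    have : b (Sum.inl i) = W.subtypeL (b₁ i) + Wᗮ.subtypeL 0 := by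
      simp only [b, OrthonormalBasis.map_apply, OrthonormalBasis.prod_apply]
      rfl
    simpa using this
  have hb₂ : ∀ i, b (Sum.inr i) = b₂ i := by
    intro i
    have : b (Sum.inr i) = W.subtypeL 0 + Wᗮ.subtypeL (b₂ i) := by
      simp only [b, OrthonormalBasis.map_apply, OrthonormalBasis.prod_apply]
      rfl
    simpa using this
  have hproj : ∀ x : Fin k ⊕ Fin l → ℝ,
      (‖W.starProjection (∑ i, x i • b i)‖ ^ 2,
        ‖∑ i, x i • b i - W.starProjection (∑ i, x i • b i)‖ ^ 2)
      = (∑ i, x (Sum.inl i) ^ 2, ∑ i, x (Sum.inr i) ^ 2) := by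
    intro x
    have hsum : ∑ i, x i • b i = ((∑ i, x (Sum.inl i) • b₁ i : W) : EuclideanSpace ℝ (Fin n))
        + ((∑ i, x (Sum.inr i) • b₂ i : Wᗮ) : EuclideanSpace ℝ (Fin n)) := by
      rw [Fintype.sum_sum_type]
      simp [hb₁, hb₂]
    have hp : W.starProjection (∑ i, x i • b i) = (∑ i, x (Sum.inl i) • b₁ i : W) :=
      Submodule.eq_starProjection_of_mem_orthogonal' (Submodule.coe_mem _)
        (Submodule.coe_mem _) hsum
    rw [hp, hsum, add_sub_cancel_left, ← Submodule.coe_norm, ← Submodule.coe_norm,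
      norm_sq_sum_smul, norm_sq_sum_smul]
  rw [stdGaussian_eq_map_pi_orthonormalBasis b, Measure.map_map (by fun_prop) (by fun_prop)]
  have hcomp : ((fun z => (‖W.starProjection z‖ ^ 2, ‖z - W.starProjection z‖ ^ 2)) ∘
      fun x : Fin k ⊕ Fin l → ℝ => ∑ i, x i • b i)
      = Prod.map (fun x : Fin k → ℝ => ∑ i, x i ^ 2) (fun x : Fin l → ℝ => ∑ i, x i ^ 2)
        ∘ MeasurableEquiv.sumPiEquivProdPi (fun _ => ℝ) := by
    funext x
    exact hproj x
  rw [hcomp, ← Measure.map_map ((measurable_sum_sq k).prodMap (measurable_sum_sq l))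
    (MeasurableEquiv.measurable _),
    (measurePreserving_sumPiEquivProdPi (fun _ : Fin k ⊕ Fin l => gaussianReal 0 1)).map_eq,
    chiSq, chiSq, Measure.map_prod_map _ _ (measurable_sum_sq k) (measurable_sum_sq l)]

lemma map_norm_sq_stdGaussian :
    (stdGaussian (EuclideanSpace ℝ (Fin n))).map (fun z => ‖z‖ ^ 2) = chiSq n := by
  rw [← map_pi_eq_stdGaussian, Measure.map_map (by fun_prop) (by fun_prop), chiSq]
  congr 1
  funext x
  simp [EuclideanSpace.real_norm_sq_eq]

lemma hasLaw_toLp_of_iIndepFun {Ω : Type*} {mΩ : MeasurableSpace Ω} {P : Measure Ω}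
    [IsProbabilityMeasure P] {σ : ℝ≥0} {ε : Fin n → Ω → ℝ}
    (hε : ∀ i, HasLaw (ε i) (gaussianReal 0 (σ ^ 2)) P) (hind : iIndepFun ε P) :
    HasLaw (fun ω => WithLp.toLp 2 (fun i => ε i ω))
      ((stdGaussian (EuclideanSpace ℝ (Fin n))).map (fun z => (σ : ℝ) • z)) P where
  aemeasurable := by
    have : AEMeasurable (fun ω i => ε i ω) P :=
      aemeasurable_pi_lambda _ fun i => (hε i).aemeasurable
    exact (by fun_prop : Measurable (WithLp.toLp 2 : (Fin n → ℝ) → _)).comp_aemeasurable this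
  map_eq := by
    have hae : AEMeasurable (fun ω i => ε i ω) P :=
      aemeasurable_pi_lambda _ fun i => (hε i).aemeasurable
    have hσ : (gaussianReal 0 1).map (fun x => (σ : ℝ) * x) = gaussianReal 0 (σ ^ 2) := by
      rw [gaussianReal_map_const_mul]
      congr 1
      · simp
      · ext
        simp
    have h1 := hind.map_fun_eq_pi_map fun i => (hε i).aemeasurable
    simp_rw [(hε _).map_eq, ← hσ] at h1
    have : ∀ i : Fin n, SigmaFinite ((gaussianReal 0 1).map (fun x => (σ : ℝ) * x)) := by
      intro i
      rw [hσ]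
      infer_instance
    rw [← Measure.pi_map_pi (fun _ => by fun_prop)] at h1
    have h2 : P.map (fun ω => WithLp.toLp 2 (fun i => ε i ω))
        = (P.map fun ω i => ε i ω).map (WithLp.toLp 2) :=
      (AEMeasurable.map_map_of_aemeasurable (by fun_prop) hae).symm
    rw [h2, h1, ← map_pi_eq_stdGaussian, Measure.map_map (by fun_prop) (by fun_prop),
      Measure.map_map (by fun_prop) (by fun_prop)]
    rfl

/-! ### Expectations of the noise terms -/

section Noise

variable {Ω : Type*} {mΩ : MeasurableSpace Ω} {P : Measure Ω} {σ : ℝ≥0}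
  {e : Ω → EuclideanSpace ℝ (Fin n)}

lemma lintegral_noise_eq
    (he : HasLaw e ((stdGaussian (EuclideanSpace ℝ (Fin n))).map (fun z => (σ : ℝ) • z)) P)
    {g : EuclideanSpace ℝ (Fin n) → ℝ≥0∞} (hg : Measurable g) :
    ∫⁻ ω, g (e ω) ∂P = ∫⁻ z, g ((σ : ℝ) • z) ∂(stdGaussian (EuclideanSpace ℝ (Fin n))) := by
  rw [← lintegral_map' (f := g) hg.aemeasurable he.aemeasurable, he.map_eq,
    lintegral_map hg (by fun_prop)]

lemma ofReal_max_sq_mul (σ : ℝ≥0) (a : ℝ) :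
    ENNReal.ofReal (max ((σ : ℝ) ^ 2 * a) 0) = (σ : ℝ≥0∞) ^ 2 * ENNReal.ofReal (max a 0) := by
  rw [show max ((σ : ℝ) ^ 2 * a) 0 = (σ : ℝ) ^ 2 * max a 0 by
    rw [mul_max_of_nonneg _ _ (by positivity), mul_zero], ENNReal.ofReal_mul (by positivity),
    ENNReal.ofReal_pow (by positivity), ENNReal.ofReal_coe_nnreal]

lemma lintegral_excess_eq
    (he : HasLaw e ((stdGaussian (EuclideanSpace ℝ (Fin n))).map (fun z => (σ : ℝ) • z)) P)
    {d : ℕ} (hd : d + 2 ≤ n) {W : Submodule ℝ (EuclideanSpace ℝ (Fin n))}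
    (hW : Module.finrank ℝ W = d + 1) {x : ℝ} (hx : 0 ≤ x) :
    ∫⁻ ω, ENNReal.ofReal (max (‖W.starProjection (e ω)‖ ^ 2
        - x / (n - d) * ‖e ω - W.starProjection (e ω)‖ ^ 2) 0) ∂P
      = (σ : ℝ≥0∞) ^ 2 * ENNReal.ofReal (expectedExcess n d x) := by
  have hN : (0 : ℝ) < (n : ℝ) - d := by
    rw [sub_pos]
    exact_mod_cast (by omega : d < n)
  rw [lintegral_noise_eq he (g := fun z => ENNReal.ofReal (max (‖W.starProjection z‖ ^ 2
        - x / (n - d) * ‖z - W.starProjection z‖ ^ 2) 0)) (by fun_prop)]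
  have h1 : ∀ z : EuclideanSpace ℝ (Fin n),
      ENNReal.ofReal (max (‖W.starProjection ((σ : ℝ) • z)‖ ^ 2
        - x / (n - d) * ‖(σ : ℝ) • z - W.starProjection ((σ : ℝ) • z)‖ ^ 2) 0)
      = (σ : ℝ≥0∞) ^ 2 * ENNReal.ofReal (max (‖W.starProjection z‖ ^ 2
        - x / (n - d) * ‖z - W.starProjection z‖ ^ 2) 0) := by
    intro z
    rw [← ofReal_max_sq_mul]
    congr 2
    rw [map_smul, ← smul_sub, norm_smul, norm_smul, Real.norm_of_nonneg σ.coe_nonneg]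
    ring
  simp_rw [h1]
  rw [lintegral_const_mul _ (by fun_prop)]
  congr 1
  rw [expectedExcess, ofReal_integral_eq_lintegral_ofReal
    (integrable_excess _ _ (div_nonneg hx hN.le)) (ae_of_all _ fun z => le_max_right _ _),
    ← map_norm_sq_starProjection_stdGaussian W hW (by omega : d + 1 + (n - d - 1) = n),
    lintegral_map (by fun_prop) (by fun_prop)]

/-- Chernoff at rate `1/4`: the threshold `4n` contributes `e⁻ⁿ`, which beats the Laplace transform
`√2 ^ n`. -/
lemma lintegral_norm_sq_sub_le
    (he : HasLaw e ((stdGaussian (EuclideanSpace ℝ (Fin n))).map (fun z => (σ : ℝ) • z)) P) :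
    ∫⁻ ω, ENNReal.ofReal (max (‖e ω‖ ^ 2 - 4 * n * (σ : ℝ) ^ 2) 0) ∂P
      ≤ (σ : ℝ≥0∞) ^ 2 * 4 := by
  rw [lintegral_noise_eq he
    (g := fun z => ENNReal.ofReal (max (‖z‖ ^ 2 - 4 * n * (σ : ℝ) ^ 2) 0)) (by fun_prop)]
  have h1 : ∀ z : EuclideanSpace ℝ (Fin n),
      ENNReal.ofReal (max (‖(σ : ℝ) • z‖ ^ 2 - 4 * n * (σ : ℝ) ^ 2) 0)
      = (σ : ℝ≥0∞) ^ 2 * ENNReal.ofReal (max (‖z‖ ^ 2 - 4 * n) 0) := by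
    intro z
    rw [← ofReal_max_sq_mul]
    congr 2
    rw [norm_smul, Real.norm_of_nonneg σ.coe_nonneg]
    ring
  simp_rw [h1]
  rw [lintegral_const_mul _ (by fun_prop)]
  gcongr
  rw [← lintegral_map (f := fun u : ℝ => ENNReal.ofReal (max (u - 4 * n) 0))
    (g := fun z : EuclideanSpace ℝ (Fin n) => ‖z‖ ^ 2) (by fun_prop) (by fun_prop),
    map_norm_sq_stdGaussian]
  have hint := (integrable_exp_mul_chiSq n (t := 1 / 4) (by norm_num)).const_mul
    (4 * Real.exp (-n))
  calc ∫⁻ u, ENNReal.ofReal (max (u - 4 * n) 0) ∂(chiSq n)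
      ≤ ∫⁻ u, ENNReal.ofReal (4 * Real.exp (-n) * Real.exp (1 / 4 * u)) ∂(chiSq n) := by
        refine lintegral_mono fun u => ENNReal.ofReal_le_ofReal ?_
        refine (max_le_four_mul_exp _).trans (le_of_eq ?_)
        rw [mul_assoc, ← Real.exp_add]
        congr 2
        ring
    _ = ENNReal.ofReal (∫ u, 4 * Real.exp (-n) * Real.exp (1 / 4 * u) ∂(chiSq n)) :=
        (ofReal_integral_eq_lintegral_ofReal hint (ae_of_all _ fun u => by positivity)).symm
    _ ≤ ENNReal.ofReal 4 := by
        refine ENNReal.ofReal_le_ofReal ?_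
        rw [integral_const_mul, integral_exp_mul_chiSq n (by norm_num)]
        have s1 : (√(1 - 2 * (1 / 4 : ℝ)))⁻¹ = √2 := by rw [← Real.sqrt_inv]; norm_num
        have s2 : √2 ≤ Real.exp 1 := by
          have := Real.add_one_le_exp (1 : ℝ)
          have : √2 ≤ 2 := by
            rw [Real.sqrt_le_left (by norm_num)]
            norm_num
          linarith
        rw [s1, mul_assoc]
        have : Real.exp (-n) * √2 ^ n ≤ 1 := by
          calc Real.exp (-n) * √2 ^ n ≤ Real.exp (-n) * Real.exp 1 ^ n := by gcongr
            _ = 1 := by rw [← Real.exp_nat_mul, ← Real.exp_add]; simp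
        linarith
    _ = 4 := by norm_num

end Noise

/-! ### The deterministic oracle inequality -/

section Deterministic

lemma norm_add_sq_le_two_mul {V : Type*} [NormedAddCommGroup V] (u v : V) : ‖u + v‖ ^ 2 ≤ 2 * ‖u‖ ^ 2 + 2 * ‖v‖ ^ 2 := by
  have h1 := norm_add_le u v
  nlinarith [sq_nonneg (‖u‖ - ‖v‖), norm_nonneg (u + v), norm_nonneg u, norm_nonneg v]

variable {V : Type*} [NormedAddCommGroup V] [InnerProductSpace ℝ V]

lemma two_mul_inner_le (W : Submodule ℝ V) [W.HasOrthogonalProjection] {K : ℝ} (hK : 0 < K)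
    (e : V) {h : V} (hh : h ∈ W) :
    2 * inner ℝ e h ≤ K⁻¹ * ‖h‖ ^ 2 + K * ‖W.starProjection e‖ ^ 2 := by
  have h1 : inner ℝ e h = inner ℝ (W.starProjection e) h := by
    rw [← sub_eq_zero, ← inner_sub_left]
    exact Submodule.starProjection_inner_eq_zero e h hh
  have h2 := real_inner_le_norm (W.starProjection e) h
  have h3 : 0 ≤ K * (‖W.starProjection e‖ - K⁻¹ * ‖h‖) ^ 2 := by positivity
  have h4 : K * (‖W.starProjection e‖ - K⁻¹ * ‖h‖) ^ 2 = K * ‖W.starProjection e‖ ^ 2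
      - 2 * (‖W.starProjection e‖ * ‖h‖) + K⁻¹ * ‖h‖ ^ 2 := by
    field_simp
    ring
  rw [h1]
  linarith

lemma norm_sub_starProjection_le (W : Submodule ℝ V) [W.HasOrthogonalProjection]
    (e : V) {w : V} (hw : w ∈ W) : ‖e - W.starProjection e‖ ≤ ‖e - w‖ := by
  rw [Submodule.starProjection_minimal]
  exact ciInf_le ⟨0, by rintro _ ⟨x, rfl⟩; exact norm_nonneg _⟩ (⟨w, hw⟩ : W)

/-- The excess of the squared norm of `Π_W e` over `q ‖e - Π_W e‖²`. -/
noncomputable def excess (W : Submodule ℝ V) [W.HasOrthogonalProjection] (q : ℝ) (e : V) : ℝ :=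
  max (‖W.starProjection e‖ ^ 2 - q * ‖e - W.starProjection e‖ ^ 2) 0

/-- From the minimality of a penalized criterion to an oracle-type inequality. -/
lemma oracle_inequality {S S' W W' : Submodule ℝ V} [S.HasOrthogonalProjection]
    [S'.HasOrthogonalProjection] [W.HasOrthogonalProjection] [W'.HasOrthogonalProjection]
    {K α q q' : ℝ} (hK : 1 < K) (hα : 0 < α) (hq : 0 ≤ q) (hq' : 0 ≤ q')
    {f e y g g' : V} (hy : y = f + e) (hSW : S ≤ W) (hfW : f ∈ W) (hSW' : S' ≤ W') (hfW' : f ∈ W')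
    (hg' : g' ∈ S')
    (hcrit : ‖y - S.starProjection g‖ ^ 2 + α * ‖g - S.starProjection g‖ ^ 2
        + K * (q * ‖y - S.starProjection y‖ ^ 2)
      ≤ ‖y - g'‖ ^ 2 + K * (q' * ‖y - S'.starProjection y‖ ^ 2)) :
    min (1 - K⁻¹) α / 2 * ‖f - g‖ ^ 2
      ≤ (2 + 2 * (K * q')) * ‖f - g'‖ ^ 2 + K * excess W q e + K * excess W' q' e
        + 3 * (K * q') * ‖e‖ ^ 2 := by
  have hK0 : 0 < K := by linarith
  have hKinv : K⁻¹ < 1 := inv_lt_one_of_one_lt₀ hK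
  set u := S.starProjection g with hu
  have huS : u ∈ S := Submodule.starProjection_apply_mem _ _
  have e1 : ‖y - u‖ ^ 2 = ‖f - u‖ ^ 2 + 2 * inner ℝ e (f - u) + ‖e‖ ^ 2 := by
    rw [hy, show f + e - u = (f - u) + e by abel, norm_add_sq_real, real_inner_comm]
  have e2 : ‖y - g'‖ ^ 2 = ‖f - g'‖ ^ 2 + 2 * inner ℝ e (f - g') + ‖e‖ ^ 2 := by
    rw [hy, show f + e - g' = (f - g') + e by abel, norm_add_sq_real, real_inner_comm]
  have i1 := two_mul_inner_le W hK0 e (W.sub_mem (hSW huS) hfW)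
  have i2 := two_mul_inner_le W' hK0 e (W'.sub_mem hfW' (hSW' hg'))
  -- The bound for `u - f` is the lower bound needed on `2⟨e, f - u⟩`.
  rw [← neg_sub f u, inner_neg_right, norm_neg] at i1
  -- Key comparison: `y - Π_S y = e - (Π_S y - f)` and `Π_S y - f ∈ W`, so the unknown `f`
  -- disappears from the residual.
  have r1 : ‖e - W.starProjection e‖ ^ 2 ≤ ‖y - S.starProjection y‖ ^ 2 := by
    have := norm_sub_starProjection_le W e
      (W.sub_mem (hSW (Submodule.starProjection_apply_mem S y)) hfW)
    rw [show e - (S.starProjection y - f) = y - S.starProjection y by rw [hy]; abel] at this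
    gcongr
  have r2 : ‖e - W'.starProjection e‖ ^ 2 ≤ ‖e‖ ^ 2 := by
    have := norm_sub_starProjection_le W' e W'.zero_mem
    rw [sub_zero] at this
    gcongr
  -- As `g' ∈ S'`, the residual is at most `‖y - g'‖`, which brings in the competitor's own risk.
  have r3 : ‖y - S'.starProjection y‖ ^ 2 ≤ 2 * ‖f - g'‖ ^ 2 + 2 * ‖e‖ ^ 2 := by
    have h1 := norm_sub_starProjection_le S' y hg'
    have h2 : ‖y - g'‖ ^ 2 ≤ 2 * ‖f - g'‖ ^ 2 + 2 * ‖e‖ ^ 2 := by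
      rw [hy, show f + e - g' = (f - g') + e by abel]
      exact norm_add_sq_le_two_mul _ _
    refine le_trans ?_ h2
    gcongr
  have x1 : ‖W.starProjection e‖ ^ 2 - q * ‖e - W.starProjection e‖ ^ 2 ≤ excess W q e :=
    le_max_left _ _
  have x2 : ‖W'.starProjection e‖ ^ 2 - q' * ‖e - W'.starProjection e‖ ^ 2 ≤ excess W' q' e :=
    le_max_left _ _
  have m1 := mul_le_mul_of_nonneg_left x1 hK0.le
  have m2 := mul_le_mul_of_nonneg_left x2 hK0.le
  have m3 := mul_le_mul_of_nonneg_left r1 (mul_nonneg hK0.le hq)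
  have m4 := mul_le_mul_of_nonneg_left r2 (mul_nonneg hK0.le hq')
  have m5 := mul_le_mul_of_nonneg_left r3 (mul_nonneg hK0.le hq')
  have m6 : K⁻¹ * ‖f - g'‖ ^ 2 ≤ ‖f - g'‖ ^ 2 :=
    mul_le_of_le_one_left (by positivity) hKinv.le
  have hfg : ‖f - g‖ ^ 2 ≤ 2 * ‖f - u‖ ^ 2 + 2 * ‖g - u‖ ^ 2 := by
    rw [show f - g = (f - u) + (u - g) by abel, ← norm_neg (g - u), neg_sub]
    exact norm_add_sq_le_two_mul _ _
  have hmin0 : 0 ≤ min (1 - K⁻¹) α := le_min (by linarith) hα.le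
  have l1 : min (1 - K⁻¹) α * ‖f - u‖ ^ 2 ≤ (1 - K⁻¹) * ‖f - u‖ ^ 2 :=
    mul_le_mul_of_nonneg_right (min_le_left _ _) (by positivity)
  have l2 : min (1 - K⁻¹) α * ‖g - u‖ ^ 2 ≤ α * ‖g - u‖ ^ 2 :=
    mul_le_mul_of_nonneg_right (min_le_right _ _) (by positivity)
  have l3 := mul_le_mul_of_nonneg_left hfg hmin0
  nlinarith

end Deterministic

/-! ### Counting the models and summing their weights -/

variable {p : ℕ}

lemma finite_modelFamily (X : Matrix (Fin n) (Fin p) ℝ) (Dmax : ℕ) :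
    (modelFamily X Dmax).Finite := by
  refine (Set.finite_range (columnSpan X)).subset ?_
  rintro S ⟨m, -, rfl⟩
  exact ⟨m, rfl⟩

/-- Extract a basis among the columns. Indexing a space by such a subset bounds the number of spaces
of dimension `d` by `p choose d`. -/
lemma exists_card_eq_finrank_columnSpan (X : Matrix (Fin n) (Fin p) ℝ) (m : Finset (Fin p)) :
    ∃ m' ⊆ m, m'.card = Module.finrank ℝ (columnSpan X m) ∧ columnSpan X m' = columnSpan X m := by
  classical
  set v : Fin p → EuclideanSpace ℝ (Fin n) := fun j => WithLp.toLp 2 (fun i => X i j) with hv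
  obtain ⟨b, hbm, -, hspan, hind⟩ := exists_linearIndepOn_extension
    (linearIndepOn_empty ℝ v) (Set.empty_subset (m : Set (Fin p)))
  have hbfin : b.Finite := m.finite_toSet.subset hbm
  have heq : columnSpan X hbfin.toFinset = columnSpan X m := by
    refine le_antisymm (Submodule.span_mono (Set.image_mono (by simpa using hbm))) ?_
    refine Submodule.span_le.2 ?_
    simpa [columnSpan] using hspan
  refine ⟨hbfin.toFinset, by simpa using hbm, ?_, heq⟩
  rw [← heq]
  have hind' : LinearIndependent ℝ (fun j : (hbfin.toFinset : Set (Fin p)) => v j) := by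
    have : LinearIndepOn ℝ v (hbfin.toFinset : Set (Fin p)) := by simpa using hind
    exact this
  have h := finrank_span_eq_card hind'
  rw [columnSpan, Set.image_eq_range, h]
  simp

lemma finrank_columnSpan_le (X : Matrix (Fin n) (Fin p) ℝ) (m : Finset (Fin p)) :
    Module.finrank ℝ (columnSpan X m) ≤ m.card := by
  obtain ⟨m', hm', hcard, -⟩ := exists_card_eq_finrank_columnSpan X m
  rw [← hcard]
  exact Finset.card_le_card hm'

lemma finrank_le_of_mem_modelFamily {X : Matrix (Fin n) (Fin p) ℝ} {Dmax : ℕ}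
    {S : Submodule ℝ (EuclideanSpace ℝ (Fin n))} (hS : S ∈ modelFamily X Dmax) :
    Module.finrank ℝ S ≤ Dmax ∧ Module.finrank ℝ S ≤ p := by
  obtain ⟨m, hm, rfl⟩ := hS
  have h := finrank_columnSpan_le X m
  exact ⟨h.trans hm, h.trans (by simpa using Finset.card_le_univ m)⟩

/-- Group by dimension: at most `p choose d` spaces, each of weight `1 / ((p choose d)(1 + d))`,
contribute at most `1 / (d + 1)`, and a harmonic sum remains. -/
lemma sum_exp_neg_weight_le (X : Matrix (Fin n) (Fin p) ℝ) (Dmax : ℕ) (hp : 2 ≤ p) :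
    ∑ S ∈ (finite_modelFamily X Dmax).toFinset, Real.exp (-weight p S) ≤ 4 * Real.log p := by
  classical
  set F := (finite_modelFamily X Dmax).toFinset with hF
  have hmem : ∀ {S}, S ∈ F → S ∈ modelFamily X Dmax := fun h => by simpa [hF] using h
  have hmaps : ∀ S ∈ F, Module.finrank ℝ S ∈ Finset.range (p + 1) := fun S hS =>
    Finset.mem_range_succ_iff.2 (finrank_le_of_mem_modelFamily (hmem hS)).2
  let G : ℕ → Finset (Submodule ℝ (EuclideanSpace ℝ (Fin n))) := fun d =>
    F.filter (fun S => Module.finrank ℝ S = d)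
  have hfiber : ∀ d ∈ Finset.range (p + 1),
      ∑ S ∈ G d, Real.exp (-weight p S) ≤ ((d : ℝ) + 1)⁻¹ := by
    intro d hd
    have hdp : d ≤ p := Finset.mem_range_succ_iff.1 hd
    have hsub : G d
        ⊆ (Finset.powersetCard d Finset.univ).image (columnSpan X) := by
      intro S hS
      rw [Finset.mem_filter] at hS
      obtain ⟨m, -, rfl⟩ := hmem hS.1
      obtain ⟨m', -, hcard, heq⟩ := exists_card_eq_finrank_columnSpan X m
      exact Finset.mem_image.2 ⟨m', Finset.mem_powersetCard.2
        ⟨Finset.subset_univ _, hcard.trans hS.2⟩, heq⟩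
    have hcard : (G d).card ≤ p.choose d := by
      refine (Finset.card_le_card hsub).trans (Finset.card_image_le.trans ?_)
      simp
    have hterm : ∀ S ∈ G d, Real.exp (-weight p S) = ((p.choose d : ℝ) * (1 + d))⁻¹ := by
      intro S hS
      rw [weight_eq_dimWeight, (Finset.mem_filter.1 hS).2, exp_neg_dimWeight hdp]
    have hc : (0 : ℝ) < p.choose d := by exact_mod_cast Nat.choose_pos hdp
    rw [Finset.sum_congr rfl hterm, Finset.sum_const, nsmul_eq_mul]
    calc ((G d).card : ℝ)
          * ((p.choose d : ℝ) * (1 + d))⁻¹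
        ≤ (p.choose d : ℝ) * ((p.choose d : ℝ) * (1 + d))⁻¹ := by gcongr
      _ = ((d : ℝ) + 1)⁻¹ := by
          field_simp
          ring
  rw [← Finset.sum_fiberwise_of_maps_to hmaps]
  refine (Finset.sum_le_sum hfiber).trans ?_
  have hharm : ∑ d ∈ Finset.range (p + 1), ((d : ℝ) + 1)⁻¹ = ((harmonic (p + 1) : ℚ) : ℝ) := by
    simp [harmonic]
  rw [hharm]
  refine (harmonic_le_one_add_log _).trans ?_
  have h2 := log_two_le_log hp
  have h3 := Real.log_two_gt_d9
  have hpR : (2 : ℝ) ≤ p := by exact_mod_cast hp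
  -- `p + 1 ≤ p²` for `p ≥ 2`; the remaining `1` is absorbed by `2 log p ≥ 2 log 2 > 1`.
  have h4 : Real.log ((p + 1 : ℕ) : ℝ) ≤ 2 * Real.log p := by
    rw [show 2 * Real.log (p : ℝ) = Real.log ((p : ℝ) ^ 2) by rw [Real.log_pow]; norm_num]
    refine Real.log_le_log (by positivity) ?_
    push_cast
    nlinarith
  linarith

/-! ### The criterion and its penalty -/

/-- The number `pen_Δ(S) / (n - dim S)`. -/
noncomputable def penRatio (p : ℕ) (S : Submodule ℝ (EuclideanSpace ℝ (Fin n))) : ℝ :=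
  penDelta p S / ((n : ℝ) - Module.finrank ℝ S)

lemma penDelta_mul_sigmaHatSq (p : ℕ) (K : ℝ) (S : Submodule ℝ (EuclideanSpace ℝ (Fin n)))
    (y : EuclideanSpace ℝ (Fin n)) :
    K * penDelta p S * sigmaHatSq S y = K * (penRatio p S * ‖y - S.starProjection y‖ ^ 2) := by
  rw [sigmaHatSq, penRatio]
  ring

lemma exists_crit_eq (p : ℕ) (K α : ℝ) {T : Set (Submodule ℝ (EuclideanSpace ℝ (Fin n)))}
    (hT : T.Finite) (hne : T.Nonempty) (y g : EuclideanSpace ℝ (Fin n)) :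
    ∃ S ∈ T, ‖y - S.starProjection g‖ ^ 2 + α * ‖g - S.starProjection g‖ ^ 2
      + K * (penRatio p S * ‖y - S.starProjection y‖ ^ 2) = crit p K α T y g := by
  have := hT.to_subtype
  have := hne.to_subtype
  obtain ⟨S, hS⟩ := exists_eq_ciInf_of_finite (f := fun S : T =>
    ‖y - (S : Submodule ℝ (EuclideanSpace ℝ (Fin n))).starProjection g‖ ^ 2
    + α * ‖g - (S : Submodule ℝ (EuclideanSpace ℝ (Fin n))).starProjection g‖ ^ 2
    + K * penDelta p (S : Submodule ℝ (EuclideanSpace ℝ (Fin n)))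
        * sigmaHatSq (S : Submodule ℝ (EuclideanSpace ℝ (Fin n))) y)
  refine ⟨S, S.2, ?_⟩
  rw [← penDelta_mul_sigmaHatSq]
  exact hS

lemma crit_le_of_mem (p : ℕ) (K α : ℝ) {T : Set (Submodule ℝ (EuclideanSpace ℝ (Fin n)))}
    (hT : T.Finite) {S : Submodule ℝ (EuclideanSpace ℝ (Fin n))} (hS : S ∈ T)
    (y : EuclideanSpace ℝ (Fin n)) {g : EuclideanSpace ℝ (Fin n)} (hg : g ∈ S) :
    crit p K α T y g ≤ ‖y - g‖ ^ 2 + K * (penRatio p S * ‖y - S.starProjection y‖ ^ 2) := by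
  have := hT.to_subtype
  refine (ciInf_le (Set.finite_range _).bddBelow (⟨S, hS⟩ : T)).trans (le_of_eq ?_)
  simp only [penDelta_mul_sigmaHatSq, Submodule.starProjection_eq_self_iff.2 hg]
  simp

section ModelFamily

variable {X : Matrix (Fin n) (Fin p) ℝ} {Dmax : ℕ}
  {S : Submodule ℝ (EuclideanSpace ℝ (Fin n))}

/-- Positivity of `Dmax` gives `max(d, 1) ≤ Dmax`, which covers `d = 0`; then `κ < 1` suffices. -/
lemma complexity_le_half {κ : ℝ} (hκ1 : κ < 1) (hp : 2 ≤ p) (hD0 : 0 < Dmax)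
    (hD : (Dmax : ℝ) ≤ κ * n / (2 * Real.log p)) {d : ℕ} (hd : d ≤ Dmax) :
    complexity p d ≤ n / 2 := by
  have hlog : 0 < Real.log p := Real.log_pos (by exact_mod_cast hp)
  have h1 : max (d : ℝ) 1 ≤ Dmax := max_le (by exact_mod_cast hd) (by exact_mod_cast hD0)
  have h2 : (Dmax : ℝ) * (2 * Real.log p) ≤ κ * n := (le_div_iff₀ (by positivity)).1 hD
  have h3 : max (d : ℝ) 1 * Real.log p ≤ Dmax * Real.log p := by gcongr
  have h4 : κ * n ≤ 1 * n := by gcongr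
  unfold complexity
  linarith

lemma penRatio_nonneg (p : ℕ) (hS : Module.finrank ℝ S + 2 ≤ n) : 0 ≤ penRatio p S := by
  refine div_nonneg (penDelta_nonneg p S) ?_
  rw [sub_nonneg]
  exact_mod_cast (by omega : Module.finrank ℝ S ≤ n)

lemma penRatio_mul_le (hp : 2 ≤ p) (hdp : Module.finrank ℝ S ≤ p)
    (hdn : Module.finrank ℝ S + 2 ≤ n) (hL : complexity p (Module.finrank ℝ S) ≤ n / 2) :
    penRatio p S * n ≤ 4 * Real.exp 40 * complexity p (Module.finrank ℝ S) := by
  have h1 := (penDelta_spec hp hdp hdn hL).2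
  have h2 := le_four_mul_sub hp hL
  have h3 : (0 : ℝ) < n := by exact_mod_cast (by omega : 0 < n)
  have h4 : (0 : ℝ) < (n : ℝ) - Module.finrank ℝ S := by linarith
  have h5 := penDelta_nonneg p S
  calc penRatio p S * n ≤ penRatio p S * (4 * ((n : ℝ) - Module.finrank ℝ S)) :=
        mul_le_mul_of_nonneg_left h2 (div_nonneg h5 h4.le)
    _ = 4 * penDelta p S := by
        rw [penRatio]
        field_simp
    _ ≤ _ := by linarith

/-- A consequence of the oracle inequality in which the penalty and the noise are decoupled. -/
lemma oracle_inequality_of_crit_le {S' W W' : Submodule ℝ (EuclideanSpace ℝ (Fin n))}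
    {K α s : ℝ} (hK : 1 < K) (hα : 0 < α) (hs : 0 ≤ s) (hp : 2 ≤ p)
    (hdn : Module.finrank ℝ S + 2 ≤ n)
    (hdp' : Module.finrank ℝ S' ≤ p) (hdn' : Module.finrank ℝ S' + 2 ≤ n)
    (hL' : complexity p (Module.finrank ℝ S') ≤ n / 2)
    {f e y g g' : EuclideanSpace ℝ (Fin n)} (hy : y = f + e) (hSW : S ≤ W) (hfW : f ∈ W)
    (hSW' : S' ≤ W') (hfW' : f ∈ W') (hg' : g' ∈ S')
    (hcrit : ‖y - S.starProjection g‖ ^ 2 + α * ‖g - S.starProjection g‖ ^ 2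
        + K * (penRatio p S * ‖y - S.starProjection y‖ ^ 2)
      ≤ ‖y - g'‖ ^ 2 + K * (penRatio p S' * ‖y - S'.starProjection y‖ ^ 2)) :
    min (1 - K⁻¹) α / 2 * ‖f - g‖ ^ 2
      ≤ (2 + 4 * K * Real.exp 40) * ‖f - g'‖ ^ 2
        + K * excess W (penRatio p S) e + K * excess W' (penRatio p S') e
        + 6 * K * Real.exp 40 * max (‖e‖ ^ 2 - 4 * n * s) 0
        + 48 * K * Real.exp 40 * (complexity p (Module.finrank ℝ S') * s) := by
  have hq' := penRatio_nonneg p hdn'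
  have hmain := oracle_inequality hK hα (penRatio_nonneg p hdn) hq' hy hSW hfW hSW' hfW' hg' hcrit
  have hmul := penRatio_mul_le hp hdp' hdn' hL'
  set q' := penRatio p S'
  set L' := complexity p (Module.finrank ℝ S')
  have hn : (0 : ℝ) < n := by exact_mod_cast (by omega : 0 < n)
  have hB := Real.exp_pos 40
  set B := Real.exp 40
  have hK0 : 0 < K := by linarith
  -- From `q' n ≤ 4BL'` and `L' ≤ n / 2`.
  have hq2 : q' ≤ 2 * B := by
    have : q' * n ≤ 2 * B * n := by nlinarith
    exact le_of_mul_le_mul_right this hn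
  have hT0 : 0 ≤ max (‖e‖ ^ 2 - 4 * n * s) 0 := le_max_right _ _
  have hT : ‖e‖ ^ 2 ≤ 4 * n * s + max (‖e‖ ^ 2 - 4 * n * s) 0 := by
    linarith [le_max_left (‖e‖ ^ 2 - 4 * n * s) 0]
  set T := max (‖e‖ ^ 2 - 4 * n * s) 0
  -- The deterministic level `4ns` meets the sharp bound on `q' n`, the remainder `T` only the crude
  -- bound on `q'`. Hence no product of a random dimension and a noise term is left.
  have h1 : q' * ‖e‖ ^ 2 ≤ 16 * B * (L' * s) + 2 * B * T := by
    calc q' * ‖e‖ ^ 2 ≤ q' * (4 * n * s + T) := mul_le_mul_of_nonneg_left hT hq'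
      _ = (q' * n) * (4 * s) + q' * T := by ring
      _ ≤ (4 * B * L') * (4 * s) + 2 * B * T := by gcongr
      _ = _ := by ring
  have h2 := mul_le_mul_of_nonneg_left h1 hK0.le
  have h3 : K * q' * ‖f - g'‖ ^ 2 ≤ K * (2 * B) * ‖f - g'‖ ^ 2 := by gcongr
  nlinarith

end ModelFamily

/-! ### Taking expectations -/

lemma ofReal_mul_enorm_sq {V : Type*} [NormedAddCommGroup V] {a : ℝ} (ha : 0 ≤ a) (v : V) :
    ENNReal.ofReal (a * ‖v‖ ^ 2) = ENNReal.ofReal a * ‖v‖ₑ ^ 2 := by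
  rw [ENNReal.ofReal_mul ha, ENNReal.ofReal_pow (norm_nonneg _), ofReal_norm]

/-- The total excess over a finite family of spaces, for enlargements of dimension `dim S + 1`. -/
noncomputable def totalExcess (p : ℕ) (F : Finset (Submodule ℝ (EuclideanSpace ℝ (Fin n))))
    (W : Submodule ℝ (EuclideanSpace ℝ (Fin n)) → Submodule ℝ (EuclideanSpace ℝ (Fin n)))
    (e : EuclideanSpace ℝ (Fin n)) : ℝ≥0∞ :=
  ∑ S ∈ F, ENNReal.ofReal (excess (W S) (penRatio p S) e)

lemma measurable_totalExcess (p : ℕ) (F : Finset (Submodule ℝ (EuclideanSpace ℝ (Fin n))))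
    (W : Submodule ℝ (EuclideanSpace ℝ (Fin n)) → Submodule ℝ (EuclideanSpace ℝ (Fin n))) :
    Measurable (totalExcess p F W) := by
  unfold totalExcess excess
  fun_prop

/-- Summing over all models bounds the excess at data-dependent ones, while each summand involves a
fixed `W S` and so has mean `σ² exp (-Δ(S))`. -/
lemma lintegral_totalExcess_le {Ω : Type*} {mΩ : MeasurableSpace Ω} {P : Measure Ω} {σ : ℝ≥0}
    {e : Ω → EuclideanSpace ℝ (Fin n)}
    (he : HasLaw e ((stdGaussian (EuclideanSpace ℝ (Fin n))).map (fun z => (σ : ℝ) • z)) P)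
    (X : Matrix (Fin n) (Fin p) ℝ) {Dmax : ℕ} (hp : 2 ≤ p) (hDn : Dmax + 2 ≤ n)
    (hL : ∀ d ≤ Dmax, complexity p d ≤ n / 2)
    {W : Submodule ℝ (EuclideanSpace ℝ (Fin n)) → Submodule ℝ (EuclideanSpace ℝ (Fin n))}
    (hW : ∀ S ∈ modelFamily X Dmax, Module.finrank ℝ (W S) = Module.finrank ℝ S + 1) :
    ∫⁻ ω, totalExcess p (finite_modelFamily X Dmax).toFinset W (e ω) ∂P
      ≤ (σ : ℝ≥0∞) ^ 2 * ENNReal.ofReal (4 * Real.log p) := by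
  unfold totalExcess
  rw [lintegral_finsetSum' _ fun S _ => by
    have : Measurable fun z => ENNReal.ofReal (excess (W S) (penRatio p S) z) := by
      unfold excess
      fun_prop
    exact this.comp_aemeasurable he.aemeasurable]
  have hterm : ∀ S ∈ (finite_modelFamily X Dmax).toFinset,
      ∫⁻ ω, ENNReal.ofReal (excess (W S) (penRatio p S) (e ω)) ∂P
        = (σ : ℝ≥0∞) ^ 2 * ENNReal.ofReal (Real.exp (-weight p S)) := by
    intro S hS
    have hS' : S ∈ modelFamily X Dmax := by simpa using hS
    obtain ⟨h1, h2⟩ := finrank_le_of_mem_modelFamily hS'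
    rw [← (penDelta_spec hp h2 (by omega) (hL _ h1)).1,
      ← lintegral_excess_eq he (by omega) (hW S hS') (penDelta_nonneg p S)]
    rfl
  rw [Finset.sum_congr rfl hterm, ← Finset.mul_sum,
    ← ENNReal.ofReal_sum_of_nonneg fun _ _ => (Real.exp_pos _).le]
  gcongr
  exact sum_exp_neg_weight_le X Dmax hp

lemma ofReal_complexity_mul (p d : ℕ) (σ : ℝ≥0) :
    ENNReal.ofReal (complexity p d * (σ : ℝ) ^ 2)
      = max (d : ℝ≥0∞) 1 * ENNReal.ofReal (Real.log p) * (σ : ℝ≥0∞) ^ 2 := by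
  rw [complexity, ENNReal.ofReal_mul (mul_nonneg (by positivity) (Real.log_natCast_nonneg p)),
    ENNReal.ofReal_mul (by positivity), ENNReal.ofReal_pow (by positivity),
    ENNReal.ofReal_coe_nnreal, ENNReal.ofReal_max]
  simp

lemma ofReal_excess_le_totalExcess (p : ℕ)
    {F : Finset (Submodule ℝ (EuclideanSpace ℝ (Fin n)))}
    (W : Submodule ℝ (EuclideanSpace ℝ (Fin n)) → Submodule ℝ (EuclideanSpace ℝ (Fin n)))
    (e : EuclideanSpace ℝ (Fin n)) {S : Submodule ℝ (EuclideanSpace ℝ (Fin n))} (hS : S ∈ F) :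
    ENNReal.ofReal (excess (W S) (penRatio p S) e) ≤ totalExcess p F W e :=
  Finset.single_le_sum (f := fun S => ENNReal.ofReal (excess (W S) (penRatio p S) e))
    (fun _ _ => zero_le) hS

/-- The oracle inequality in `[0, ∞]`, with the noise terms replaced by the total excess. -/
lemma ennreal_oracle_inequality {X : Matrix (Fin n) (Fin p) ℝ} {Dmax : ℕ} {K α : ℝ}
    (hK : 1 < K) (hα : 0 < α) (hp : 2 ≤ p) (hDn : Dmax + 2 ≤ n)
    (hL : ∀ d ≤ Dmax, complexity p d ≤ n / 2) (σ : ℝ≥0) {f e y g g' : EuclideanSpace ℝ (Fin n)}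
    {W : Submodule ℝ (EuclideanSpace ℝ (Fin n)) → Submodule ℝ (EuclideanSpace ℝ (Fin n))}
    (hW : ∀ S ∈ modelFamily X Dmax, S ≤ W S ∧ f ∈ W S)
    (hy : y = f + e) {T T' : Set (Submodule ℝ (EuclideanSpace ℝ (Fin n)))}
    (hT : T ⊆ modelFamily X Dmax) (hTne : T.Nonempty) (hT' : T' ⊆ modelFamily X Dmax)
    {S' : Submodule ℝ (EuclideanSpace ℝ (Fin n))} (hS' : S' ∈ T') (hg' : g' ∈ S')
    (hcrit : crit p K α T y g ≤ crit p K α T' y g') :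
    ENNReal.ofReal (min (1 - K⁻¹) α / 2) * ‖f - g‖ₑ ^ 2
      ≤ ENNReal.ofReal (2 + 4 * K * Real.exp 40) * ‖f - g'‖ₑ ^ 2
        + ENNReal.ofReal (2 * K) * totalExcess p (finite_modelFamily X Dmax).toFinset W e
        + ENNReal.ofReal (6 * K * Real.exp 40)
          * ENNReal.ofReal (max (‖e‖ ^ 2 - 4 * n * (σ : ℝ) ^ 2) 0)
        + ENNReal.ofReal (48 * K * Real.exp 40)
          * (max (Module.finrank ℝ S' : ℝ≥0∞) 1 * ENNReal.ofReal (Real.log p)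
            * (σ : ℝ≥0∞) ^ 2) := by
  have hfin := finite_modelFamily X Dmax
  obtain ⟨S, hS, hSeq⟩ := exists_crit_eq p K α (hfin.subset hT) hTne y g
  have hcrit' := hSeq.le.trans (hcrit.trans (crit_le_of_mem p K α (hfin.subset hT') hS' y hg'))
  have hSF := hT hS
  have hSF' := hT' hS'
  have hd := finrank_le_of_mem_modelFamily hSF
  have hd' := finrank_le_of_mem_modelFamily hSF'
  have hdet := oracle_inequality_of_crit_le hK hα (sq_nonneg (σ : ℝ)) hp (by omega) hd'.2
    (by omega) (hL _ hd'.1) hy (hW S hSF).1 (hW S hSF).2 (hW S' hSF').1 (hW S' hSF').2 hg' hcrit'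
  have hK0 : 0 ≤ K := by linarith
  have hc : 0 ≤ min (1 - K⁻¹) α / 2 :=
    div_nonneg (le_min (by linarith [inv_lt_one_of_one_lt₀ hK]) hα.le) (by norm_num)
  have hx : ∀ S : Submodule ℝ (EuclideanSpace ℝ (Fin n)), 0 ≤ excess (W S) (penRatio p S) e :=
    fun S => le_max_right _ _
  have hsum : ∀ S ∈ modelFamily X Dmax, ENNReal.ofReal (K * excess (W S) (penRatio p S) e)
      ≤ ENNReal.ofReal K * totalExcess p hfin.toFinset W e := by
    intro S hS
    rw [ENNReal.ofReal_mul hK0]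
    gcongr
    exact ofReal_excess_le_totalExcess p W e (by simpa using hS)
  rw [← ofReal_mul_enorm_sq hc, ← ofReal_mul_enorm_sq (by positivity), ← ofReal_complexity_mul,
    ← ENNReal.ofReal_mul (by positivity), ← ENNReal.ofReal_mul (by positivity)]
  refine (ENNReal.ofReal_le_ofReal hdet).trans ?_
  refine ENNReal.ofReal_add_le.trans (add_le_add ?_ le_rfl)
  refine ENNReal.ofReal_add_le.trans (add_le_add ?_ le_rfl)
  refine ENNReal.ofReal_add_le.trans ((add_le_add ENNReal.ofReal_add_le le_rfl).trans ?_)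
  rw [add_assoc, two_mul, ENNReal.ofReal_add hK0 hK0, add_mul (ENNReal.ofReal K)]
  exact add_le_add le_rfl (add_le_add (hsum S hSF) (hsum S' hSF'))

/-- The oracle inequality in expectation. -/
lemma lintegral_oracle_inequality {Ω : Type*} {mΩ : MeasurableSpace Ω} {P : Measure Ω}
    [IsProbabilityMeasure P] {σ : ℝ≥0} {e : Ω → EuclideanSpace ℝ (Fin n)}
    (he : HasLaw e ((stdGaussian (EuclideanSpace ℝ (Fin n))).map (fun z => (σ : ℝ) • z)) P)
    (X : Matrix (Fin n) (Fin p) ℝ) {Dmax : ℕ} {K α : ℝ}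
    (hK : 1 < K) (hα : 0 < α) (hp : 2 ≤ p) (hDn : Dmax + 2 ≤ n)
    (hL : ∀ d ≤ Dmax, complexity p d ≤ n / 2) (f : EuclideanSpace ℝ (Fin n))
    {g g' : Ω → EuclideanSpace ℝ (Fin n)} (hg' : AEMeasurable g' P)
    {T T' : Ω → Set (Submodule ℝ (EuclideanSpace ℝ (Fin n)))}
    (hT : ∀ ω, T ω ⊆ modelFamily X Dmax) (hTne : ∀ ω, (T ω).Nonempty)
    (hT' : ∀ ω, T' ω ⊆ modelFamily X Dmax)
    {S' : Ω → Submodule ℝ (EuclideanSpace ℝ (Fin n))} (hS' : ∀ ω, S' ω ∈ T' ω)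
    (hgS' : ∀ᵐ ω ∂P, g' ω ∈ S' ω)
    (hcrit : ∀ ω, crit p K α (T ω) (f + e ω) (g ω) ≤ crit p K α (T' ω) (f + e ω) (g' ω)) :
    ENNReal.ofReal (min (1 - K⁻¹) α / 2) * ∫⁻ ω, ‖f - g ω‖ₑ ^ 2 ∂P
      ≤ ENNReal.ofReal (200 * K * Real.exp 40) * (∫⁻ ω, ‖f - g' ω‖ₑ ^ 2 ∂P
        + (∫⁻ ω, max (Module.finrank ℝ (S' ω) : ℝ≥0∞) 1 ∂P)
          * ENNReal.ofReal (Real.log p) * (σ : ℝ≥0∞) ^ 2) := by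
  -- The enlargement depends on `S` and `f` only, not on `ω`, which the distributional computation
  -- requires.
  have hW : ∀ S : Submodule ℝ (EuclideanSpace ℝ (Fin n)), ∃ W : Submodule ℝ _,
      S ∈ modelFamily X Dmax →
        S ≤ W ∧ f ∈ W ∧ Module.finrank ℝ W = Module.finrank ℝ S + 1 := by
    intro S
    by_cases hS : S ∈ modelFamily X Dmax
    · have := (finrank_le_of_mem_modelFamily hS).1
      obtain ⟨W, hW⟩ := exists_finrank_eq_succ_of_lt S f (by
        rw [finrank_euclideanSpace_fin]
        omega)
      exact ⟨W, fun _ => hW⟩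
    · exact ⟨S, fun h => absurd h hS⟩
  choose W hW using hW
  set R : Ω → ℝ≥0∞ := fun ω => totalExcess p (finite_modelFamily X Dmax).toFinset W (e ω)
  set N : Ω → ℝ≥0∞ := fun ω => ENNReal.ofReal (max (‖e ω‖ ^ 2 - 4 * n * (σ : ℝ) ^ 2) 0)
  set J := ∫⁻ ω, max (Module.finrank ℝ (S' ω) : ℝ≥0∞) 1 ∂P
  set l := ENNReal.ofReal (Real.log p) with hl
  set B := Real.exp 40
  have hpt : ∀ᵐ ω ∂P, ENNReal.ofReal (min (1 - K⁻¹) α / 2) * ‖f - g ω‖ₑ ^ 2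
      ≤ ENNReal.ofReal (2 + 4 * K * B) * ‖f - g' ω‖ₑ ^ 2 + ENNReal.ofReal (2 * K) * R ω
        + ENNReal.ofReal (6 * K * B) * N ω
        + ENNReal.ofReal (48 * K * B)
          * (max (Module.finrank ℝ (S' ω) : ℝ≥0∞) 1 * l * (σ : ℝ≥0∞) ^ 2) := by
    filter_upwards [hgS'] with ω hω
    exact ennreal_oracle_inequality hK hα hp hDn hL σ
      (fun S hS => ⟨(hW S hS).1, (hW S hS).2.1⟩) rfl (hT ω) (hTne ω) (hT' ω) (hS' ω) hω (hcrit ω)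
  have hRm : AEMeasurable R P :=
    (measurable_totalExcess p _ W).comp_aemeasurable he.aemeasurable
  have hNm : AEMeasurable N P := by
    have : Measurable fun z : EuclideanSpace ℝ (Fin n) =>
        ENNReal.ofReal (max (‖z‖ ^ 2 - 4 * n * (σ : ℝ) ^ 2) 0) := by fun_prop
    exact this.comp_aemeasurable he.aemeasurable
  have hGm : AEMeasurable (fun ω => ‖f - g' ω‖ₑ ^ 2) P := by fun_prop
  have hRle : ∫⁻ ω, R ω ∂P ≤ (σ : ℝ≥0∞) ^ 2 * ENNReal.ofReal (4 * Real.log p) :=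
    lintegral_totalExcess_le he X hp hDn hL fun S hS => (hW S hS).2.2
  have hNle : ∫⁻ ω, N ω ∂P ≤ (σ : ℝ≥0∞) ^ 2 * 4 := lintegral_norm_sq_sub_le he
  -- With `1 ≤ 2 log p`, this lets `Q` absorb every bare multiple of `σ²` and `σ² log p`.
  have hJ : 1 ≤ J := by
    calc (1 : ℝ≥0∞) = ∫⁻ _, 1 ∂P := by simp
      _ ≤ J := lintegral_mono fun ω => le_max_right _ _
  have h4l : ENNReal.ofReal (4 * Real.log p) = ENNReal.ofReal 4 * l :=
    ENNReal.ofReal_mul (by norm_num)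
  have h1l : 1 ≤ ENNReal.ofReal 2 * l := by
    rw [hl, ← ENNReal.ofReal_mul (by norm_num), ← ENNReal.ofReal_one]
    refine ENNReal.ofReal_le_ofReal ?_
    linarith [log_two_le_log hp, Real.log_two_gt_d9]
  have hslJ : l * (σ : ℝ≥0∞) ^ 2 ≤ J * l * (σ : ℝ≥0∞) ^ 2 := by
    rw [mul_assoc]
    exact le_mul_of_one_le_left zero_le hJ
  set Q := J * l * (σ : ℝ≥0∞) ^ 2
  have hRQ : ∫⁻ ω, R ω ∂P ≤ ENNReal.ofReal 4 * Q := by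
    refine hRle.trans ?_
    rw [h4l]
    calc (σ : ℝ≥0∞) ^ 2 * (ENNReal.ofReal 4 * l) = ENNReal.ofReal 4 * (l * (σ : ℝ≥0∞) ^ 2) := by
          ring
      _ ≤ _ := by gcongr
  have hNQ : ∫⁻ ω, N ω ∂P ≤ ENNReal.ofReal 8 * Q := by
    refine hNle.trans ?_
    have h4 : (4 : ℝ≥0∞) = ENNReal.ofReal 4 := by norm_num
    have h8 : ENNReal.ofReal 8 = ENNReal.ofReal 4 * ENNReal.ofReal 2 := by
      rw [← ENNReal.ofReal_mul (by norm_num)]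
      norm_num
    calc (σ : ℝ≥0∞) ^ 2 * 4 = (σ : ℝ≥0∞) ^ 2 * ENNReal.ofReal 4 * 1 := by rw [h4, mul_one]
      _ ≤ (σ : ℝ≥0∞) ^ 2 * ENNReal.ofReal 4 * (ENNReal.ofReal 2 * l) := by gcongr
      _ = ENNReal.ofReal 8 * (l * (σ : ℝ≥0∞) ^ 2) := by
          rw [h8]
          ring
      _ ≤ _ := by gcongr
  have hB1 : 1 ≤ B := Real.one_le_exp (by norm_num)
  have hKB : K ≤ K * B := le_mul_of_one_le_right (by linarith) hB1
  have hK0 : 0 < K := by linarith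
  rw [← lintegral_const_mul' _ _ ENNReal.ofReal_ne_top]
  calc ∫⁻ ω, ENNReal.ofReal (min (1 - K⁻¹) α / 2) * ‖f - g ω‖ₑ ^ 2 ∂P
      ≤ _ := lintegral_mono_ae hpt
    _ = ENNReal.ofReal (2 + 4 * K * B) * ∫⁻ ω, ‖f - g' ω‖ₑ ^ 2 ∂P
        + ENNReal.ofReal (2 * K) * ∫⁻ ω, R ω ∂P + ENNReal.ofReal (6 * K * B) * ∫⁻ ω, N ω ∂P
        + ENNReal.ofReal (48 * K * B) * Q := by
        -- The dimension term is the last summand, so additivity asks for measurability of the other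
        -- terms only.
        rw [lintegral_add_left' (by fun_prop), lintegral_add_left' (by fun_prop),
          lintegral_add_left' (by fun_prop), lintegral_const_mul' _ _ ENNReal.ofReal_ne_top,
          lintegral_const_mul' _ _ ENNReal.ofReal_ne_top,
          lintegral_const_mul' _ _ ENNReal.ofReal_ne_top,
          lintegral_const_mul' _ _ ENNReal.ofReal_ne_top,
          lintegral_mul_const' _ _ (by finiteness), lintegral_mul_const' _ _ ENNReal.ofReal_ne_top]
    _ ≤ ENNReal.ofReal (200 * K * B) * ∫⁻ ω, ‖f - g' ω‖ₑ ^ 2 ∂P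
        + ENNReal.ofReal (2 * K) * (ENNReal.ofReal 4 * Q)
        + ENNReal.ofReal (6 * K * B) * (ENNReal.ofReal 8 * Q)
        + ENNReal.ofReal (48 * K * B) * Q := by
        gcongr
        nlinarith
    _ = ENNReal.ofReal (200 * K * B) * ∫⁻ ω, ‖f - g' ω‖ₑ ^ 2 ∂P
        + ENNReal.ofReal (2 * K * 4 + 6 * K * B * 8 + 48 * K * B) * Q := by
        clear_value Q
        rw [← mul_assoc, ← mul_assoc, ← ENNReal.ofReal_mul (by positivity),
          ← ENNReal.ofReal_mul (by positivity), add_assoc, add_assoc, ← add_mul, ← add_mul,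
          ← ENNReal.ofReal_add (by positivity) (by positivity),
          ← ENNReal.ofReal_add (by positivity) (by positivity), ← add_assoc (2 * K * 4)]
    -- Since `K ≤ K * B`, the total `8K + 96KB` is at most `104KB`, below the round constant 200.
    _ ≤ _ := by
        rw [mul_add]
        gcongr
        nlinarith

end EstimatorSelection


theorem corollary3 (K κ α : ℝ) (hK : 1 < K) (hκ0 : 0 < κ) (hκ1 : κ < 1) (hα : 0 < α) :
    ∃ C : ℝ, 0 < C ∧
      ∀ (n p Dmax : ℕ) (_ : 2 ≤ p) (_ : 0 < Dmax) (_ : Dmax + 2 ≤ n)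
        (_ : (Dmax : ℝ) ≤ κ * n / (2 * Real.log p))
        -- the design and the observation `Y = f + ε`
        (X : Matrix (Fin n) (Fin p) ℝ) (f : EuclideanSpace ℝ (Fin n)) (σ : ℝ≥0) (_ : 0 < σ)
        (Ω : Type*) (_ : MeasurableSpace Ω) (P : Measure Ω) (_ : IsProbabilityMeasure P)
        (ε : Fin n → Ω → ℝ) (_ : ∀ i, HasLaw (ε i) (gaussianReal 0 (σ ^ 2)) P)
        (_ : iIndepFun ε P)
        (Y : Ω → EuclideanSpace ℝ (Fin n)) (_ : ∀ ω i, Y ω i = f i + ε i ω)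
        -- the random subsets of predictors, as functions of the observation
        (Λ : Type*) (_ : Finite Λ)
        (mhat : Λ → EuclideanSpace ℝ (Fin n) → Finset (Fin p))
        (_ : ∀ l m, MeasurableSet {y | mhat l y = m})
        (_ : ∀ l y, (mhat l y).card ≤ Dmax)
        -- the estimators, as functions of the observation
        (fhat : Λ → EuclideanSpace ℝ (Fin n) → EuclideanSpace ℝ (Fin n))
        (_ : ∀ l, Measurable (fhat l))
        (_ : ∀ l, ∀ᵐ ω ∂P,
          fhat l (Y ω) ∈ EstimatorSelection.columnSpan X (mhat l (Y ω)))
        -- the (random) families of approximation spaces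
        (T : Λ → EuclideanSpace ℝ (Fin n) → Set (Submodule ℝ (EuclideanSpace ℝ (Fin n))))
        (_ : ∀ l y, T l y ⊆ EstimatorSelection.modelFamily X Dmax)
        (_ : ∀ l y, EstimatorSelection.columnSpan X (mhat l y) ∈ T l y)
        -- the selected index minimizes the criterion
        (lhat : EuclideanSpace ℝ (Fin n) → Λ)
        (_ : Measurable (fun y => fhat (lhat y) y))
        (_ : ∀ y l, EstimatorSelection.crit p K α (T (lhat y) y) y (fhat (lhat y) y)
          ≤ EstimatorSelection.crit p K α (T l y) y (fhat l y)),
        ((∀ l, ∀ᵐ ω ∂P, EstimatorSelection.columnSpan X (mhat l (Y ω)) ≠ ⊥) →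
          ENNReal.ofReal C * ∫⁻ ω, ‖f - fhat (lhat (Y ω)) (Y ω)‖ₑ ^ 2 ∂P
            ≤ ⨅ l, (∫⁻ ω, ‖f - fhat l (Y ω)‖ₑ ^ 2 ∂P
              + (∫⁻ ω, (Module.finrank ℝ
                  (EstimatorSelection.columnSpan X (mhat l (Y ω))) : ℝ≥0∞) ∂P)
                * ENNReal.ofReal (Real.log p) * (σ : ℝ≥0∞) ^ 2))
        ∧ ENNReal.ofReal C * ∫⁻ ω, ‖f - fhat (lhat (Y ω)) (Y ω)‖ₑ ^ 2 ∂P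
            ≤ ⨅ l, (∫⁻ ω, ‖f - fhat l (Y ω)‖ₑ ^ 2 ∂P
              + (∫⁻ ω, max (Module.finrank ℝ
                  (EstimatorSelection.columnSpan X (mhat l (Y ω))) : ℝ≥0∞) 1 ∂P)
                * ENNReal.ofReal (Real.log p) * (σ : ℝ≥0∞) ^ 2) := by
  have hK0 : 0 < K := by linarith
  have hc : 0 < min (1 - K⁻¹) α / 2 :=
    div_pos (lt_min (by linarith [inv_lt_one_of_one_lt₀ hK]) hα) (by norm_num)
  have hM : 0 < 200 * K * Real.exp 40 := by positivity
  -- Ratio of the two constants of `lintegral_oracle_inequality`.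
  refine ⟨min (1 - K⁻¹) α / 2 / (200 * K * Real.exp 40), div_pos hc hM, ?_⟩
  intro n p Dmax hp hD0 hDn hD X f σ _ Ω _ P _ ε hε hind Y hY Λ _ mhat _ hmcard fhat hfm hfS T hT
    hmT lhat _ hmin
  have hbound : ENNReal.ofReal (min (1 - K⁻¹) α / 2 / (200 * K * Real.exp 40))
        * ∫⁻ ω, ‖f - fhat (lhat (Y ω)) (Y ω)‖ₑ ^ 2 ∂P
      ≤ ⨅ l, (∫⁻ ω, ‖f - fhat l (Y ω)‖ₑ ^ 2 ∂P
        + (∫⁻ ω, max (Module.finrank ℝ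
            (EstimatorSelection.columnSpan X (mhat l (Y ω))) : ℝ≥0∞) 1 ∂P)
          * ENNReal.ofReal (Real.log p) * (σ : ℝ≥0∞) ^ 2) := by
    refine le_iInf fun l => ?_
    have he := EstimatorSelection.hasLaw_toLp_of_iIndepFun hε hind
    have hYe : ∀ ω, Y ω = f + WithLp.toLp 2 (fun i => ε i ω) := by
      intro ω
      ext i
      simp [hY ω i]
    have hYm : AEMeasurable Y P := by
      rw [funext hYe]
      exact he.aemeasurable.const_add f
    have h := EstimatorSelection.lintegral_oracle_inequality he X hK hα hp hDn
      (fun d hd => EstimatorSelection.complexity_le_half hκ1 hp hD0 hD hd) f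
      (g := fun ω => fhat (lhat (Y ω)) (Y ω)) (g' := fun ω => fhat l (Y ω))
      ((hfm l).comp_aemeasurable hYm) (fun ω => hT (lhat (Y ω)) (Y ω))
      (fun ω => ⟨_, hmT (lhat (Y ω)) (Y ω)⟩) (fun ω => hT l (Y ω))
      (S' := fun ω => EstimatorSelection.columnSpan X (mhat l (Y ω)))
      (fun ω => hmT l (Y ω)) (hfS l)
      (fun ω => by
        rw [← hYe ω]
        exact hmin (Y ω) l)
    rw [ENNReal.ofReal_div_of_pos hM, ENNReal.div_eq_inv_mul, mul_assoc]
    exact (ENNReal.inv_mul_le_iff (by simpa using hM) ENNReal.ofReal_ne_top).2 h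
  refine ⟨fun hne => hbound.trans (iInf_mono fun l => ?_), hbound⟩
  -- A nonzero space has dimension at least 1, so the maximum with 1 is almost surely the dimension
  -- itself.
  gcongr _ + ?_ * _ * _
  refine lintegral_mono_ae ?_
  filter_upwards [hne l] with ω hω
  refine max_le le_rfl ?_
  exact_mod_cast Nat.one_le_iff_ne_zero.2 fun h => hω (Submodule.finrank_eq_zero.1 h)
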